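/- Let $D\subseteq\mathbb{R}^n$ be open and convex and let $f:D\to\mathbb{R}$ be convex and twice continuously differentiable, with gradient $g(x)$ and positive definite Hessian $H(x)$ with respect to a fixed reference inner product $\langle\cdot,\cdot\rangle$ on $\mathbb{R}^n$. For $x,y\in D$ write $\langle u,v\rangle_x=\langle u,H(x)v\rangle$, $\|u\|_x=\sqrt{\langle u,u\rangle_x}$, and $g_x(y)=H(x)^{-1}g(y)$ (the gradient of $f$ at $y$ with respect to $\langle\cdot,\cdot\rangle_x$). The function $f$ is called self-concordant if for every $x\in D$ the open ball $B_x=\{y\in\mathbb{R}^n:\|y-x\|_x<1\}$ is contained in $D$ and, for all $y\in B_x$ and all $v\neq 0$, $$1-\|y-x\|_x\;\le\;\frac{\|v\|_y}{\|v\|_x}\;\le\;\frac{1}{1-\|y-x\|_x}.$$ Assume that $f$ is self-concordant with minimizer $x_*\in D$. Let $0<\delta<1$, put $\kappa_\delta=(1-\delta)^4$, and let $x_0\in D$ satisfy $\|x_0-x_*\|_{x_*}\le\frac12\delta$. Let $x_1=x_0-\gamma d$, where $$\|d-g_{x_*}(x_0)\|_{x_*}\le\varepsilon\,\|g_{x_*}(x_0)\|_{x_*},\qquad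 \varepsilon\le\frac{2\kappa_\delta}{1+\kappa_\delta},\qquad \gamma=\frac{2(1-\delta)^4-\varepsilon\bigl(1+(1-\delta)^4\bigr)}{(1-\varepsilon)(1-\delta)^2\bigl((1-\delta)^4+1\bigr)}.$$ Then $x_1\in D$ and $$\|g_{x_*}(x_1)\|_{x_*}\le\Bigl(\frac{1-\kappa_\delta}{1+\kappa_\delta}+\varepsilon\Bigr)\|g_{x_*}(x_0)\|_{x_*},\qquad \|x_1-x_*\|_{x_*}\le\Bigl(\frac{1-\kappa_\delta}{1+\kappa_\delta}+\varepsilon\Bigr)\|x_0-x_*\|_{x_*}.$$ -/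

import Mathlib

noncomputable section

/-- The Hessian of `f` at `x` with respect to the (reference) inner product of `E`:
the Fréchet derivative of the gradient field, a linear operator on `E`. -/
def hessian {E : Type*} [NormedAddCommGroup E] [InnerProductSpace ℝ E] [CompleteSpace E]
    (f : E → ℝ) (x : E) : E →L[ℝ] E :=
  fderiv ℝ (gradient f) x

/-- The intrinsic (local) inner product `⟨u, v⟩_x = ⟨u, H(x) v⟩`. -/
def localInner {E : Type*} [NormedAddCommGroup E] [InnerProductSpace ℝ E] [CompleteSpace E]
    (f : E → ℝ) (x u v : E) : ℝ :=
  inner ℝ u (hessian f x v)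

/-- The norm `‖u‖_x` induced by the intrinsic inner product at `x`. -/
def localNorm {E : Type*} [NormedAddCommGroup E] [InnerProductSpace ℝ E] [CompleteSpace E]
    (f : E → ℝ) (x u : E) : ℝ :=
  Real.sqrt (localInner f x u u)

/-- The open ball `B_x(c, r)` with respect to the norm `‖·‖_x`. -/
def localBall {E : Type*} [NormedAddCommGroup E] [InnerProductSpace ℝ E] [CompleteSpace E]
    (f : E → ℝ) (x c : E) (r : ℝ) : Set E :=
  {y | localNorm f x (y - c) < r}

/-- The gradient `g_x(y) = H(x)⁻¹ g(y)` of `f` at `y` with respect to the intrinsic inner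
product at `x`. -/
def localGradient {E : Type*} [NormedAddCommGroup E] [InnerProductSpace ℝ E] [CompleteSpace E]
    (f : E → ℝ) (x y : E) : E :=
  (hessian f x).inverse (gradient f y)

/-- Self-concordant functions in the sense of Renegar: convex, twice continuously differentiable
functions on an open convex domain `D` with positive definite Hessians, such that every local unit
ball `B_x(x, 1)` with `x ∈ D` is contained in `D` and the local norms compare on it. -/
structure IsSelfConcordant {E : Type*} [NormedAddCommGroup E] [InnerProductSpace ℝ E]
    [CompleteSpace E] (f : E → ℝ) (D : Set E) : Prop where
  isOpen : IsOpen D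
  convexOn : ConvexOn ℝ D f
  contDiffOn : ContDiffOn ℝ 2 f D
  hessian_pos : ∀ x ∈ D, ∀ v : E, v ≠ 0 → 0 < localInner f x v v
  ball_subset : ∀ x ∈ D, localBall f x x 1 ⊆ D
  norm_ratio : ∀ x ∈ D, ∀ y ∈ localBall f x x 1, ∀ v : E, v ≠ 0 →
    1 - localNorm f x (y - x) ≤ localNorm f y v / localNorm f x v ∧
      localNorm f y v / localNorm f x v ≤ 1 / (1 - localNorm f x (y - x))

end

/-!
Write `μ = (1 - δ) ^ 2` and `L = μ⁻¹`. By self-concordance the Hessian of `f`, measured in the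
intrinsic inner product at the minimizer `xs`, lies between `μ` and `L` on the local ball of radius
`δ` around `xs`. In that inner product `f` is thus `μ`-strongly convex and `L`-smooth on the ball,
with condition number `L / μ = κ⁻¹`, and `x₁` results from one inexact gradient step. The step size
is `γ = (2μ - ε(L + μ)) / ((1 - ε)μ(L + μ))` and the claimed rate is `1 - γμ(1 - ε)`.

The only property of `f` used in the estimates is the quadratic inequality
`‖w‖² + Lμ‖d‖² ≤ (L + μ)⟪w, d⟫` between a displacement `d` in the ball and the difference `w` of the
gradients at its ends (`IsSelfConcordant.localGradient_sector`). For the distance, it is applied to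
the pair `xs`, `x₀`, and the triangle inequality with two AM-GM steps gives the contraction
(`norm_sub_smul_le_of_sector`). As the rate is at most `1`, the point `x₁` stays in the ball. For
the gradient, the inequality is applied to the pair `x₁`, `x₀`; the contraction is then an S-lemma
certificate: a nonnegative combination of this inequality and of the accuracy hypothesis on `d`,
plus one square (`norm_sub_smul_le_of_sector_of_norm_sub_le`).
-/

/-! ### Inexact gradient steps in an inner product space -/

/-- One inexact gradient step contracts the distance to the minimizer. Here `u` is the displacement
from the minimizer, `g` the gradient and `d` the inexact direction. -/
theorem norm_sub_smul_le_of_sector {V : Type*} [NormedAddCommGroup V]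
    [InnerProductSpace ℝ V] {μ L ε γ : ℝ} (hμ : 0 < μ) (hμL : μ < L) (hε0 : 0 ≤ ε) (hε1 : ε < 1)
    (hγ0 : 0 ≤ γ) (hγ : γ * ((1 - ε) * μ * (L + μ)) = 2 * μ - ε * (L + μ)) {u g d : V}
    (hsec : ‖g‖ ^ 2 + L * μ * ‖u‖ ^ 2 ≤ (L + μ) * inner ℝ g u)
    (hd : ‖d - g‖ ≤ ε * ‖g‖) :
    ‖u - γ • d‖ ≤ (1 - γ * μ * (1 - ε)) * ‖u‖ := by
  have hLμ : 0 < L + μ := by linarith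
  have hA : 0 < 1 - γ * μ := by
    have h1 : 0 < (1 - γ * μ) * ((1 - ε) * (L + μ)) := by
      have : (1 - γ * μ) * ((1 - ε) * (L + μ)) = L - μ := by linear_combination -hγ
      rw [this]; linarith
    exact pos_of_mul_pos_left h1 (by nlinarith)
  have htri : ‖u - γ • d‖ ≤ ‖u - γ • g‖ + γ * (ε * ‖g‖) := by
    calc ‖u - γ • d‖ = ‖(u - γ • g) - γ • (d - g)‖ := by congr 1; module
      _ ≤ ‖u - γ • g‖ + ‖γ • (d - g)‖ := norm_sub_le _ _
      _ ≤ _ := by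
        rw [norm_smul, Real.norm_of_nonneg hγ0]
        gcongr
  have hX : ‖u - γ • g‖ ^ 2 = ‖u‖ ^ 2 - 2 * γ * inner ℝ g u + γ ^ 2 * ‖g‖ ^ 2 := by
    rw [norm_sub_sq_real, inner_smul_right, norm_smul, Real.norm_of_nonneg hγ0,
      real_inner_comm]
    ring
  rcases (norm_nonneg u).eq_or_lt with hu | hu
  · have hu0 : u = 0 := norm_eq_zero.1 hu.symm
    subst hu0
    have hg : g = 0 := by
      simp only [norm_zero, inner_zero_right] at hsec
      have : ‖g‖ ^ 2 ≤ 0 := by linarith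
      simpa using this
    subst hg
    simpa using htri
  · refine htri.trans ?_
    -- This form of the step size cancels the terms in `‖g‖ ^ 2` once both norms are linearized by
    -- AM-GM around the worst case `g = μ • u`.
    have hkey : (L + μ) * ((1 - γ * μ) * ε) = μ * (2 - γ * (L + μ)) := by
      linear_combination hγ
    have h1 := sq_nonneg (‖u - γ • g‖ - (1 - γ * μ) * ‖u‖)
    have h2 := sq_nonneg (‖g‖ - μ * ‖u‖)
    have hpos : 0 < 2 * (1 - γ * μ) * μ * (L + μ) * ‖u‖ := by positivity
    have hc : 0 ≤ (1 - γ * μ) * γ * ε := by positivity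
    refine le_of_mul_le_mul_left ?_ hpos
    generalize ‖u - γ • g‖ = X at *
    generalize ‖u‖ = U at *
    generalize ‖g‖ = G at *
    generalize (inner ℝ g u : ℝ) = p at *
    have h1' := mul_nonneg (mul_nonneg hμ.le hLμ.le) h1
    have h2' := mul_nonneg (mul_nonneg hc hLμ.le) h2
    have h3' := mul_nonneg (mul_nonneg hγ0 hμ.le) (sub_nonneg.2 hsec)
    rw [← sub_nonneg]
    have hid : 2 * (1 - γ * μ) * μ * (L + μ) * U * ((1 - γ * μ * (1 - ε)) * U)
        - 2 * (1 - γ * μ) * μ * (L + μ) * U * (X + γ * (ε * G))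
        = μ * (L + μ) * (X - (1 - γ * μ) * U) ^ 2
          + (1 - γ * μ) * γ * ε * (L + μ) * (G - μ * U) ^ 2
          + 2 * (γ * μ * ((L + μ) * p - (G ^ 2 + L * μ * U ^ 2))) := by
      linear_combination (-μ * (L + μ)) * hX + (γ * (μ ^ 2 * U ^ 2 - G ^ 2)) * hkey
    rw [hid]; linarith

/-- One inexact gradient step contracts the gradient. Here `g` is the gradient, `d` the inexact
direction and `γ • w` the change of the gradient along the step `γ • d`. -/
theorem norm_sub_smul_le_of_sector_of_norm_sub_le {V : Type*} [NormedAddCommGroup V]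
    [InnerProductSpace ℝ V] {μ L ε γ : ℝ} (hμ : 0 < μ) (hμL : μ < L) (hε0 : 0 ≤ ε) (hε1 : ε < 1)
    (hγ0 : 0 ≤ γ) (hρ : 0 ≤ 1 - γ * μ * (1 - ε))
    (hγ : γ * ((1 - ε) * μ * (L + μ)) = 2 * μ - ε * (L + μ)) {g d w : V}
    (hsec : ‖w‖ ^ 2 + L * μ * ‖d‖ ^ 2 ≤ (L + μ) * inner ℝ w d)
    (hd : ‖d - g‖ ≤ ε * ‖g‖) :
    ‖g - γ • w‖ ≤ (1 - γ * μ * (1 - ε)) * ‖g‖ := by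
  have hLμ : 0 < L + μ := by linarith
  have hLμ' : 0 < L - μ := by linarith
  have hε1' : 0 < 1 - ε := by linarith
  refine le_of_sq_le_sq ?_ (by positivity)
  have hX : ‖g - γ • w‖ ^ 2 = ‖g‖ ^ 2 - 2 * γ * inner ℝ g w + γ ^ 2 * ‖w‖ ^ 2 := by
    rw [norm_sub_sq_real, inner_smul_right, norm_smul, Real.norm_of_nonneg hγ0]
    ring
  have hd2 : ‖d - g‖ ^ 2 ≤ ε ^ 2 * ‖g‖ ^ 2 := by
    rw [← mul_pow]; gcongr
  rw [hX]
  rcases hε0.eq_or_lt with he | he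
  · subst he
    have : d = g := by
      rw [zero_mul] at hd
      exact sub_eq_zero.1 (norm_le_zero_iff.1 hd)
    subst this
    have hγ' : γ * (L + μ) = 2 := by
      have : μ * (γ * (L + μ)) = μ * 2 := by linear_combination hγ
      exact mul_left_cancel₀ hμ.ne' this
    rw [real_inner_comm] at hsec
    have hnonneg := mul_nonneg (sq_nonneg γ) (sub_nonneg.2 hsec)
    have hid : ((1 - γ * μ * (1 - 0)) * ‖d‖) ^ 2
        - (‖d‖ ^ 2 - 2 * γ * inner ℝ d w + γ ^ 2 * ‖w‖ ^ 2)
        = γ ^ 2 * ((L + μ) * inner ℝ d w - (‖w‖ ^ 2 + L * μ * ‖d‖ ^ 2)) := by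
      linear_combination (γ * μ * ‖d‖ ^ 2 - γ * inner ℝ d w) * hγ'
    linarith
  · -- The worst case is `d = (1 - ε) • g`, `w = μ • d`. The multipliers `h1`, `h2` of the two
    -- hypotheses make the difference of the two sides vanish to first order there; what remains
    -- is a single square, of a vector that vanishes in the worst case.
    have hS : ‖(ε * (L + μ)) • w - (μ * (L - μ + ε * (L + μ))) • d
          + (μ * (1 - ε) * (L - μ)) • g‖ ^ 2
        = (ε * (L + μ)) ^ 2 * ‖w‖ ^ 2 + (μ * (L - μ + ε * (L + μ))) ^ 2 * ‖d‖ ^ 2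
          + (μ * (1 - ε) * (L - μ)) ^ 2 * ‖g‖ ^ 2
          - 2 * (ε * (L + μ)) * (μ * (L - μ + ε * (L + μ))) * inner ℝ w d
          + 2 * (ε * (L + μ)) * (μ * (1 - ε) * (L - μ)) * inner ℝ g w
          - 2 * (μ * (L - μ + ε * (L + μ))) * (μ * (1 - ε) * (L - μ)) * inner ℝ d g := by
      rw [norm_add_sq_real, norm_sub_sq_real, inner_sub_left]
      simp only [real_inner_smul_left, real_inner_smul_right, norm_smul, mul_pow, Real.norm_eq_abs,
        sq_abs, real_inner_comm w g]
      ring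
    have hdg : ‖d - g‖ ^ 2 = ‖d‖ ^ 2 - 2 * inner ℝ d g + ‖g‖ ^ 2 := norm_sub_sq_real d g
    have hSnn := mul_nonneg hγ0 (hS ▸ sq_nonneg ‖(ε * (L + μ)) • w
      - (μ * (L - μ + ε * (L + μ))) • d + (μ * (1 - ε) * (L - μ)) • g‖)
    have hK : 0 < ε * μ * (L + μ) * (1 - ε) * (L - μ) := by positivity
    rw [hdg] at hd2
    have h1 := mul_nonneg (by positivity :
      0 ≤ μ ^ 2 * γ * (1 - γ * μ * (1 - ε)) * (L + μ) * (1 - ε) * (L - μ)) (sub_nonneg.2 hd2)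
    have h2 := mul_nonneg (by positivity :
      0 ≤ 2 * γ * (1 - γ * μ * (1 - ε)) * ε * μ * (L + μ)) (sub_nonneg.2 hsec)
    refine le_of_mul_le_mul_left ?_ hK
    have hγ' : γ = (2 * μ - ε * (L + μ)) / ((1 - ε) * μ * (L + μ)) := by
      rw [eq_div_iff (by positivity)]; exact hγ
    generalize ‖g‖ = G at *
    generalize ‖d‖ = D at *
    generalize ‖w‖ = W at *
    generalize (inner ℝ w d : ℝ) = p at *
    generalize (inner ℝ g w : ℝ) = q at *
    generalize (inner ℝ d g : ℝ) = r at *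
    rw [← sub_nonneg]
    refine (add_nonneg (add_nonneg h1 h2) hSnn).trans_eq ?_
    clear h1 h2 hSnn hS hX hdg hd2 hsec hd hγ hρ hγ0
    subst hγ'
    have hne : 1 - ε ≠ 0 := hε1'.ne'
    field_simp
    ring

/-! ### The intrinsic inner product of a self-concordant function -/

universe u

section

variable {E : Type u} [NormedAddCommGroup E] [InnerProductSpace ℝ E] [CompleteSpace E]
  {f : E → ℝ} {D : Set E} {x : E}

theorem inner_gradient_eq_fderiv (f : E → ℝ) (x v : E) :
    inner ℝ (gradient f x) v = fderiv ℝ f x v := by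
  simp [gradient]

theorem IsSelfConcordant.hasFDerivAt_gradient (hf : IsSelfConcordant f D) (hx : x ∈ D) :
    HasFDerivAt (gradient f) (hessian f x) x := by
  have h1 : ContDiffAt ℝ 1 (fderiv ℝ f) x :=
    (hf.contDiffOn.contDiffAt (hf.isOpen.mem_nhds hx)).fderiv_right (by norm_num)
  have h2 : DifferentiableAt ℝ (gradient f) x :=
    ((InnerProductSpace.toDual ℝ E).symm.toContinuousLinearEquiv.differentiableAt).comp x
      (h1.differentiableAt (by norm_num))
  exact h2.hasFDerivAt

theorem IsSelfConcordant.localInner_comm (hf : IsSelfConcordant f D) (hx : x ∈ D) (u v : E) :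
    localInner f x u v = localInner f x v u := by
  have hsymm : IsSymmSndFDerivAt ℝ f x :=
    (hf.contDiffOn.contDiffAt (hf.isOpen.mem_nhds hx)).isSymmSndFDerivAt (by simp)
  have h1 : ContDiffAt ℝ 1 (fderiv ℝ f) x :=
    (hf.contDiffOn.contDiffAt (hf.isOpen.mem_nhds hx)).fderiv_right (by norm_num)
  have key : ∀ u v, localInner f x u v = fderiv ℝ (fderiv ℝ f) x v u := by
    intro u v
    have ha : HasFDerivAt (fun y => (gradient f y)) (hessian f x) x := hf.hasFDerivAt_gradient hx
    have hb : HasFDerivAt (fun y => inner ℝ (gradient f y) u)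
        ((ContinuousLinearMap.apply ℝ ℝ u).comp (fderiv ℝ (fderiv ℝ f) x)) x := by
      simp only [inner_gradient_eq_fderiv]
      exact (ContinuousLinearMap.apply ℝ ℝ u).hasFDerivAt.comp x
        (h1.differentiableAt (by norm_num)).hasFDerivAt
    have hc := (ha.inner ℝ (hasFDerivAt_const u x)).unique hb
    have := DFunLike.congr_fun hc v
    simp at this
    rw [localInner, real_inner_comm, this]
  rw [key, key, hsymm]

/-- The intrinsic inner product at `x` makes `E` into an inner product space `V`. Carrying it on a
separate type, through a linear equivalence `T`, keeps it apart from the reference inner product. -/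
theorem IsSelfConcordant.exists_linearEquiv_inner_eq_localInner (hf : IsSelfConcordant f D)
    (hx : x ∈ D) : ∃ (V : Type u) (_ : NormedAddCommGroup V) (_ : InnerProductSpace ℝ V)
      (T : E ≃ₗ[ℝ] V), ∀ u v, inner ℝ (T u) (T v) = localInner f x u v := by
  let c : InnerProductSpace.Core ℝ E :=
    { inner := localInner f x
      conj_inner_symm := fun u v => by simpa using hf.localInner_comm hx v u
      re_inner_nonneg := fun v => by
        rcases eq_or_ne v 0 with rfl | hv
        · simp [localInner]
        · simpa using (hf.hessian_pos x hx v hv).le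
      add_left := fun u v w => by simp [localInner, inner_add_left]
      smul_left := fun u v r => by simp [localInner, real_inner_smul_left]
      definite := fun v hv => by
        by_contra h
        exact (hf.hessian_pos x hx v h).ne' hv }
  exact ⟨E, @InnerProductSpace.Core.toNormedAddCommGroup ℝ E _ _ _ c,
    InnerProductSpace.ofCore c.toCore, LinearEquiv.refl ℝ E, fun _ _ => rfl⟩

theorem localNorm_eq_norm {V : Type*} [NormedAddCommGroup V] [InnerProductSpace ℝ V]
    {T : E ≃ₗ[ℝ] V} (hT : ∀ u v, inner ℝ (T u) (T v) = localInner f x u v) (v : E) :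
    localNorm f x v = ‖T v‖ := by
  rw [localNorm, ← hT, real_inner_self_eq_norm_sq, Real.sqrt_sq (norm_nonneg _)]

theorem IsSelfConcordant.localInner_self (hf : IsSelfConcordant f D) (hx : x ∈ D) (v : E) :
    localInner f x v v = localNorm f x v ^ 2 := by
  obtain ⟨V, _, _, T, hT⟩ := hf.exists_linearEquiv_inner_eq_localInner hx
  rw [localNorm_eq_norm hT, ← hT, real_inner_self_eq_norm_sq]

theorem IsSelfConcordant.localNorm_pos (hf : IsSelfConcordant f D) (hx : x ∈ D) {v : E}
    (hv : v ≠ 0) : 0 < localNorm f x v := Real.sqrt_pos.2 (hf.hessian_pos x hx v hv)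

theorem IsSelfConcordant.convex_setOf_localNorm_sub_le (hf : IsSelfConcordant f D) (hx : x ∈ D)
    (c : E) (r : ℝ) :
    Convex ℝ {y | localNorm f x (y - c) ≤ r} := by
  obtain ⟨V, _, _, T, hT⟩ := hf.exists_linearEquiv_inner_eq_localInner hx
  convert (convex_closedBall (T c) r).linear_preimage T.toLinearMap using 1
  ext y
  change localNorm f x (y - c) ≤ r ↔ T y ∈ Metric.closedBall (T c) r
  rw [localNorm_eq_norm hT, mem_closedBall_iff_norm, map_sub]

theorem IsSelfConcordant.hessian_localGradient [FiniteDimensional ℝ E] (hf : IsSelfConcordant f D)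
    (hx : x ∈ D) (y : E) : hessian f x (localGradient f x y) = gradient f y := by
  have hinj : Function.Injective (hessian f x : E →ₗ[ℝ] E) := by
    rw [injective_iff_map_eq_zero]
    intro v hv
    by_contra h
    have := hf.hessian_pos x hx v h
    have hv' : hessian f x v = 0 := hv
    simp [localInner, hv'] at this
  let e : E ≃L[ℝ] E := (LinearEquiv.ofInjectiveEndo _ hinj).toContinuousLinearEquiv
  have he : hessian f x = (e : E →L[ℝ] E) := by ext v; rfl
  rw [localGradient, he, ContinuousLinearMap.inverse_equiv]
  simp

/-- On the local ball of radius `δ < 1` around `x`, the Hessian, measured in the intrinsic inner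
product at `x`, has its spectrum in `[μ, μ⁻¹]` with `μ = (1 - δ) ^ 2`. -/
theorem IsSelfConcordant.localInner_bounds (hf : IsSelfConcordant f D) (hx : x ∈ D) {y : E} {δ : ℝ}
    (hδ1 : δ < 1) (hy : localNorm f x (y - x) ≤ δ) (v : E) :
    (1 - δ) ^ 2 * localInner f x v v ≤ localInner f y v v ∧
      localInner f y v v ≤ ((1 - δ) ^ 2)⁻¹ * localInner f x v v := by
  rcases eq_or_ne v 0 with rfl | hv
  · simp [localInner]
  have hyB : y ∈ localBall f x x 1 := hy.trans_lt hδ1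
  have hyD := hf.ball_subset x hx hyB
  obtain ⟨h1, h2⟩ := hf.norm_ratio x hx y hyB v hv
  have hp := hf.localNorm_pos hx hv
  have hδ : 0 < 1 - δ := by linarith
  have h1' : 1 - δ ≤ localNorm f y v / localNorm f x v := by linarith
  have h2' : localNorm f y v / localNorm f x v ≤ 1 / (1 - δ) := h2.trans (by gcongr)
  rw [le_div_iff₀ hp] at h1'
  rw [div_le_iff₀ hp] at h2'
  rw [hf.localInner_self hx, hf.localInner_self hyD, ← mul_pow, ← inv_pow, ← mul_pow, ← one_div]
  exact ⟨by gcongr, pow_le_pow_left₀ (Real.sqrt_nonneg _) h2' 2⟩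

/-- Cocoercivity of the intrinsic gradient: if the Hessian lies between `μ` and `L` on a convex
set, then `⟨w - μ d, L d - w⟩_x ≥ 0`, where `d` is a displacement in that set and `w` the
corresponding difference of intrinsic gradients. -/
theorem IsSelfConcordant.localGradient_sector [FiniteDimensional ℝ E]
    (hf : IsSelfConcordant f D) (hx : x ∈ D) {s : Set E} (hs : Convex ℝ s) (hsD : s ⊆ D)
    {μ L : ℝ} (hμL : μ < L)
    (hbd : ∀ z ∈ s, ∀ v, μ * localInner f x v v ≤ localInner f z v v ∧
      localInner f z v v ≤ L * localInner f x v v)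
    {y₀ y₁ : E} (hy₀ : y₀ ∈ s) (hy₁ : y₁ ∈ s) {w : E}
    (hw : w = localGradient f x y₁ - localGradient f x y₀) :
    localInner f x w w + L * μ * localInner f x (y₁ - y₀) (y₁ - y₀)
      ≤ (L + μ) * localInner f x w (y₁ - y₀) := by
  set d := y₁ - y₀ with hd
  -- The claim says that `‖a‖_x ≤ (L - μ) ‖d‖_x`. The mean value theorem, applied to the component
  -- of the gradient along this very vector `a`, needs the Hessian at a single point `z` only.
  set a := (2 : ℝ) • w - (L + μ) • d with ha
  obtain ⟨z, hz, hmvt⟩ := domain_mvt (f := fun y => inner ℝ (gradient f y) a)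
    (f' := fun y => (innerSL ℝ a).comp (hessian f y)) (s := s) (fun z hz => by
      have := (innerSL ℝ a).hasFDerivAt.comp z (hf.hasFDerivAt_gradient (hsD hz))
      refine HasFDerivAt.hasFDerivWithinAt (this.congr_of_eventuallyEq (.of_forall fun y => ?_))
      simp [real_inner_comm]) hs hy₀ hy₁
  have hzs : z ∈ s := hs.segment_subset hy₀ hy₁ hz
  have hmvt' : localInner f x a w = localInner f z a d := by
    have : localInner f x a w = inner ℝ (gradient f y₁) a - inner ℝ (gradient f y₀) a := by
      rw [hw, localInner, map_sub, hf.hessian_localGradient hx, hf.hessian_localGradient hx,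
        inner_sub_right, real_inner_comm a, real_inner_comm a]
    rw [this, hmvt]; rfl
  have hcx := hf.localInner_comm hx
  have hcz := hf.localInner_comm (hsD hzs)
  -- Polarization: `2 H(z) - (L + μ) H(x)` is symmetric and bounded by `(L - μ) H(x)`; it is
  -- tested on `a ± (L - μ) • d`, which balances the two terms.
  have h1 := (hbd z hzs (a + (L - μ) • d)).2
  have h2 := (hbd z hzs (a - (L - μ) • d)).1
  have hadd : ∀ y u v t, localInner f y (u + v) t = localInner f y u t + localInner f y v t := by
    intros; simp [localInner, inner_add_left]
  have hsub : ∀ y u v t, localInner f y (u - v) t = localInner f y u t - localInner f y v t := by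
    intros; simp [localInner, inner_sub_left]
  have hsm : ∀ y (c : ℝ) u t, localInner f y (c • u) t = c * localInner f y u t := by
    intros; simp [localInner, real_inner_smul_left]
  have hadd' : ∀ y u v t, localInner f y t (u + v) = localInner f y t u + localInner f y t v := by
    intros; simp [localInner, inner_add_right]
  have hsub' : ∀ y u v t, localInner f y t (u - v) = localInner f y t u - localInner f y t v := by
    intros; simp [localInner, inner_sub_right]
  have hsm' : ∀ y (c : ℝ) u t, localInner f y t (c • u) = c * localInner f y t u := by
    intros; simp [localInner, real_inner_smul_right]
  have hk : 0 < L - μ := sub_pos.2 hμL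
  have haw : localInner f x a a = 2 * localInner f z a d - (L + μ) * localInner f x a d := by
    rw [← hmvt']
    conv_lhs => rw [ha, hsub', hsm', hsm']
  have haa : localInner f x a a = 4 * localInner f x w w
      - 4 * (L + μ) * localInner f x w d + (L + μ) ^ 2 * localInner f x d d := by
    rw [ha]
    simp only [hsub, hsub', hsm, hsm', hcx d w]
    ring
  have hle : localInner f x a a ≤ (L - μ) ^ 2 * localInner f x d d := by
    simp only [hadd, hadd', hsub, hsub', hsm, hsm', hcx d a, hcz d a] at h1 h2
    refine le_of_mul_le_mul_left ?_ hk
    linear_combination h1 + h2 + 2 * (L - μ) * haw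
  linear_combination (1 / 4) * hle - (1 / 4) * haa

end

/-! ### Contraction of the inexact gradient step -/

theorem mainTheorem5 {E : Type*} [NormedAddCommGroup E] [InnerProductSpace ℝ E]
    [FiniteDimensional ℝ E] [CompleteSpace E]
    (f : E → ℝ) (D : Set E) (hf : IsSelfConcordant f D)
    (xs : E) (hxs : xs ∈ D) (hmin : IsMinOn f D xs)
    (δ : ℝ) (hδ0 : 0 < δ) (hδ1 : δ < 1)
    (x₀ : E) (hx₀ : x₀ ∈ D) (hdist : localNorm f xs (x₀ - xs) ≤ δ / 2)
    (κ : ℝ) (hκ : κ = (1 - δ) ^ 4)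
    (ε : ℝ) (hε : ε ≤ 2 * κ / (1 + κ))
    (d : E)
    (hd : localNorm f xs (d - localGradient f xs x₀) ≤ ε * localNorm f xs (localGradient f xs x₀))
    (γ : ℝ)
    (hγ : γ = (2 * (1 - δ) ^ 4 - ε * (1 + (1 - δ) ^ 4)) /
      ((1 - ε) * (1 - δ) ^ 2 * ((1 - δ) ^ 4 + 1)))
    (x₁ : E) (hx₁ : x₁ = x₀ - γ • d) :
    x₁ ∈ D ∧
      localNorm f xs (localGradient f xs x₁) ≤
        ((1 - κ) / (1 + κ) + ε) * localNorm f xs (localGradient f xs x₀) ∧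
      localNorm f xs (x₁ - xs) ≤ ((1 - κ) / (1 + κ) + ε) * localNorm f xs (x₀ - xs) := by
  have hδ : 0 < 1 - δ := sub_pos.2 hδ1
  have hκ0 : 0 < κ := hκ ▸ pow_pos hδ 4
  have hκ1 : κ < 1 := hκ ▸ pow_lt_one₀ hδ.le (by linarith) (by norm_num)
  have hε1 : ε < 1 := hε.trans_lt (by rw [div_lt_one (by linarith)]; linarith)
  obtain ⟨V, _, _, T, hT⟩ := hf.exists_linearEquiv_inner_eq_localInner hxs
  have hgs : localGradient f xs xs = 0 := by
    have h : gradient f xs = 0 := by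
      simp [gradient, (hmin.isLocalMin (hf.isOpen.mem_nhds hxs)).fderiv_eq_zero]
    rw [localGradient, h, map_zero]
  set s : Set E := {y | localNorm f xs (y - xs) ≤ δ} with hs
  have hsD : s ⊆ D := fun y hy => hf.ball_subset xs hxs (lt_of_le_of_lt hy hδ1)
  set μ : ℝ := (1 - δ) ^ 2 with hμ
  have hμ0 : 0 < μ := pow_pos hδ 2
  have hμ1 : μ < 1 := pow_lt_one₀ hδ.le (by linarith) (by norm_num)
  have hμL : μ < μ⁻¹ := hμ1.trans ((one_lt_inv₀ hμ0).2 hμ1)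
  have hκμ : κ = μ ^ 2 := by rw [hκ, hμ]; ring
  have hsec : ∀ {y₀ y₁ : E}, y₀ ∈ s → y₁ ∈ s →
      ‖T (localGradient f xs y₁ - localGradient f xs y₀)‖ ^ 2 + μ⁻¹ * μ * ‖T (y₁ - y₀)‖ ^ 2
        ≤ (μ⁻¹ + μ) * inner ℝ (T (localGradient f xs y₁ - localGradient f xs y₀))
          (T (y₁ - y₀)) := by
    intro y₀ y₁ h₀ h₁
    have := hf.localGradient_sector hxs (hf.convex_setOf_localNorm_sub_le hxs xs δ) hsD hμL
      (fun z hz v => hf.localInner_bounds hxs hδ1 hz v) h₀ h₁ rfl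
    simpa only [← hT, real_inner_self_eq_norm_sq] using this
  have hxs_s : xs ∈ s := by simp [hs, localNorm, localInner, hδ0.le]
  have hx₀s : x₀ ∈ s := hdist.trans (by linarith)
  -- A negative `ε` is possible only if the gradient at `x₀` vanishes; then `x₁ = x₀ = xs`.
  rcases lt_or_ge ε 0 with hε0 | hε0
  · rw [localNorm_eq_norm hT, localNorm_eq_norm hT] at hd
    have hg : T (localGradient f xs x₀) = 0 := by
      rw [← norm_le_zero_iff]
      nlinarith [norm_nonneg (T (d - localGradient f xs x₀)),
        norm_nonneg (T (localGradient f xs x₀))]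
    have hd0 : d = 0 := by
      rw [hg, norm_zero, mul_zero, norm_le_zero_iff, map_sub, hg, sub_zero] at hd
      simpa using hd
    have hu : x₀ - xs = 0 := by
      have := hsec hxs_s hx₀s
      rw [hgs, sub_zero, hg, inner_zero_left, norm_zero, inv_mul_cancel₀ hμ0.ne'] at this
      have h : T (x₀ - xs) = 0 := by
        rw [← norm_eq_zero, ← sq_eq_zero_iff]
        exact le_antisymm (by linarith) (sq_nonneg _)
      exact T.map_eq_zero_iff.1 h
    have hx₁₀ : x₁ = x₀ := by rw [hx₁, hd0, smul_zero, sub_zero]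
    rw [hx₁₀, localNorm_eq_norm hT, localNorm_eq_norm hT, hg, hu]
    simpa using hx₀
  have hγ' : γ * ((1 - ε) * μ * (μ⁻¹ + μ)) = 2 * μ - ε * (μ⁻¹ + μ) := by
    have h1 : 1 - ε ≠ 0 := (sub_pos.2 hε1).ne'
    have h4 : (1 - δ) ^ 4 = μ ^ 2 := by rw [← hκ, hκμ]
    rw [hγ, h4]
    field_simp
    ring
  have hγ0 : 0 ≤ γ := by
    rw [hγ, ← hκ]
    rw [le_div_iff₀ (by linarith)] at hε
    have : 0 < 1 - ε := sub_pos.2 hε1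
    exact div_nonneg (by linarith) (by positivity)
  have hρ : (1 - κ) / (1 + κ) + ε = 1 - γ * μ * (1 - ε) := by
    have h : γ * μ * (1 - ε) * (1 + κ) = 2 * κ - ε * (1 + κ) := by
      rw [hκμ]
      have : (μ⁻¹ + μ) * μ = 1 + μ ^ 2 := by field_simp
      linear_combination μ * hγ' + (-(γ * (1 - ε) * μ) - ε) * this
    field_simp
    linear_combination h
  have hρ0 : 0 ≤ 1 - γ * μ * (1 - ε) := by
    rw [← hρ]
    exact add_nonneg (div_nonneg (by linarith) (by linarith)) hε0
  have hρ1 : 1 - γ * μ * (1 - ε) ≤ 1 := by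
    have : 0 ≤ γ * μ * (1 - ε) := mul_nonneg (mul_nonneg hγ0 hμ0.le) (by linarith)
    linarith
  rw [localNorm_eq_norm hT, localNorm_eq_norm hT, map_sub] at hd
  have hdist₁ : localNorm f xs (x₁ - xs) ≤ (1 - γ * μ * (1 - ε)) * localNorm f xs (x₀ - xs) := by
    have h := hsec hxs_s hx₀s
    rw [hgs, sub_zero] at h
    have := norm_sub_smul_le_of_sector hμ0 hμL hε0 hε1 hγ0 hγ' h hd
    rw [localNorm_eq_norm hT, localNorm_eq_norm hT]
    convert this using 2
    rw [hx₁, ← map_smul, ← map_sub]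
    congr 1
    abel
  have hx₁s : x₁ ∈ s := by
    refine hdist₁.trans ?_
    have h0 : 0 ≤ localNorm f xs (x₀ - xs) := Real.sqrt_nonneg _
    nlinarith
  rw [hρ]
  refine ⟨hsD hx₁s, ?_, hdist₁⟩
  rcases hγ0.eq_or_lt with h0 | hγpos
  · have : x₁ = x₀ := by rw [hx₁, ← h0, zero_smul, sub_zero]
    rw [this, ← h0]
    simp
  · have h := hsec hx₁s hx₀s
    have hx : x₀ - x₁ = γ • d := by rw [hx₁]; abel
    -- `w` is the averaged Hessian on the segment from `x₁` to `x₀`, applied to `d`.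
    set w := γ⁻¹ • T (localGradient f xs x₀ - localGradient f xs x₁) with hw
    have hwγ : T (localGradient f xs x₀ - localGradient f xs x₁) = γ • w := by
      rw [hw, smul_inv_smul₀ hγpos.ne']
    clear_value w
    have hsec' : ‖w‖ ^ 2 + μ⁻¹ * μ * ‖T d‖ ^ 2 ≤ (μ⁻¹ + μ) * inner ℝ w (T d) := by
      rw [hwγ, hx, map_smul, norm_smul, norm_smul _ (T d), real_inner_smul_left, real_inner_smul_right,
        mul_pow, mul_pow, Real.norm_of_nonneg hγ0] at h
      refine le_of_mul_le_mul_left ?_ (pow_pos hγpos 2)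
      linarith
    have := norm_sub_smul_le_of_sector_of_norm_sub_le hμ0 hμL hε0 hε1 hγ0 hρ0 hγ' hsec' hd
    rw [← hwγ, ← map_sub, sub_sub_cancel] at this
    rwa [localNorm_eq_norm hT, localNorm_eq_norm hT]
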